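/- For $m,n\in\mathbb N=\{1,2,\dots\}$ let $\mathcal O_n^m(\mathbb R)$ be the space of all $f\in C^m(\mathbb R)$ (real valued) with $$|f|_{m,n}:=\sup_{x\in\mathbb R}\ \sup_{0\le i\le m}(1+x^2)^{-n}|f^{(i)}(x)|<\infty,$$ endowed with the norm $|\cdot|_{m,n}$. Let $\mathcal O^m(\mathbb R)=\bigcup_{n\ge1}\mathcal O_n^m(\mathbb R)$ carry the locally convex inductive limit topology (the finest locally convex topology for which all inclusions $\mathcal O_n^m(\mathbb R)\to\mathcal O^m(\mathbb R)$ are continuous), and let $\mathcal O_M(\mathbb R)=\bigcap_{m\ge1}\mathcal O^m(\mathbb R)$ carry the projective limit topology (the coarsest topology for which all inclusions $\mathcal O_M(\mathbb R)\to\mathcal O^m(\mathbb R)$ are continuous). For $\varphi\in\mathcal O_M(\mathbb R)$ the composition operator $C_\varphi f=f\circ\varphi$ is a continuous linear operator on $\mathcal O_M(\mathbb R)$. For $n\in\mathbb N$ let $\varphi_n=\varphi\circ\cdots\circ\varphi$ ($n$ times) be the $n$-th iterate of $\varphi$, which again belongs to $\mathcal O_M(\mathbb R)$. **Corollary.** Let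 $\varphi\in\mathcal O_M(\mathbb R)$ be increasing, i.e. $\varphi(x)<\varphi(y)$ whenever $x<y$. Then the following are equivalent: 1. the sequence $(C_{\varphi_n})_{n\in\mathbb N}$ is convergent in $\mathcal L_s(\mathcal O_M(\mathbb R))$, the space of continuous linear operators on $\mathcal O_M(\mathbb R)$ with the strong operator topology (pointwise convergence on $\mathcal O_M(\mathbb R)$); 2. $C_\varphi$ is power bounded on $\mathcal O_M(\mathbb R)$, i.e. $\{C_\varphi^n: n\in\mathbb N\}$ is equicontinuous; 3. the set $\{\varphi_n: n\in\mathbb N\}$ is bounded in $\mathcal O_M(\mathbb R)$. -/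

import Mathlib

open Filter Topology

noncomputable section

namespace SlowGrowth

/-- The weighted derivatives `(1 + x²)⁻ⁿ |f⁽ⁱ⁾(x)|`, for `0 ≤ i ≤ m` and `x ∈ ℝ`. -/
def weighted (m n : ℕ) (f : ℝ → ℝ) (p : Fin (m + 1) × ℝ) : ℝ :=
  ((1 + p.2 ^ 2) ^ n)⁻¹ * |iteratedDeriv p.1 f p.2|

theorem weighted_nonneg (m n : ℕ) (f : ℝ → ℝ) (p : Fin (m + 1) × ℝ) : 0 ≤ weighted m n f p := by
  unfold weighted
  positivity

theorem weighted_add_le {m : ℕ} (n : ℕ) {f g : ℝ → ℝ} (hf : ContDiff ℝ m f) (hg : ContDiff ℝ m g)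
    (p : Fin (m + 1) × ℝ) : weighted m n (f + g) p ≤ weighted m n f p + weighted m n g p := by
  have hp : ((p.1 : ℕ) : WithTop ℕ∞) ≤ m := by exact_mod_cast Nat.lt_succ_iff.mp p.1.2
  unfold weighted
  rw [iteratedDeriv_add (hf.of_le hp).contDiffAt (hg.of_le hp).contDiffAt, ← mul_add]
  exact mul_le_mul_of_nonneg_left (abs_add_le _ _) (by positivity)

theorem weighted_smul (m n : ℕ) (c : ℝ) (f : ℝ → ℝ) (p : Fin (m + 1) × ℝ) :
    weighted m n (c • f) p = |c| * weighted m n f p := by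
  unfold weighted
  rw [iteratedDeriv_const_smul_field, smul_eq_mul, abs_mul]
  ring

/-- The vector space `𝒪_n^m(ℝ)` of the `C^m` functions `f : ℝ → ℝ` with
`sup_x sup_{0 ≤ i ≤ m} (1 + x²)⁻ⁿ |f⁽ⁱ⁾(x)| < ∞`. -/
def stepSubmodule (m n : ℕ) : Submodule ℝ (ℝ → ℝ) where
  carrier := {f | ContDiff ℝ m f ∧ BddAbove (Set.range (weighted m n f))}
  zero_mem' := by
    refine ⟨contDiff_const, 0, ?_⟩
    rintro _ ⟨p, rfl⟩
    have := weighted_smul m n 0 0 p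
    simp only [zero_smul, abs_zero, zero_mul] at this
    exact this.le
  add_mem' := by
    rintro f g ⟨hf, C, hC⟩ ⟨hg, D, hD⟩
    refine ⟨hf.add hg, C + D, ?_⟩
    rintro _ ⟨p, rfl⟩
    exact (weighted_add_le n hf hg p).trans (add_le_add (hC ⟨p, rfl⟩) (hD ⟨p, rfl⟩))
  smul_mem' := by
    rintro c f ⟨hf, C, hC⟩
    refine ⟨contDiff_const.smul hf, |c| * C, ?_⟩
    rintro _ ⟨p, rfl⟩
    rw [weighted_smul]
    exact mul_le_mul_of_nonneg_left (hC ⟨p, rfl⟩) (abs_nonneg c)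

theorem stepSubmodule_mono (m : ℕ) : Monotone (stepSubmodule m) := by
  rintro n n' h f ⟨hf, C, hC⟩
  refine ⟨hf, C, ?_⟩
  rintro _ ⟨p, rfl⟩
  refine le_trans ?_ (hC ⟨p, rfl⟩)
  unfold weighted
  gcongr
  nlinarith [sq_nonneg p.2]

/-- The space `𝒪_n^m(ℝ)`, as a type of its own (it carries the norm `|·|_{m,n}` below, not the
topology of pointwise convergence). -/
def OStep (m n : ℕ) : Type := stepSubmodule m n

instance (m n : ℕ) : AddCommGroup (OStep m n) := inferInstanceAs (AddCommGroup (stepSubmodule m n))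

instance (m n : ℕ) : Module ℝ (OStep m n) := inferInstanceAs (Module ℝ (stepSubmodule m n))

/-- The norm `|f|_{m,n} = sup_x sup_{0 ≤ i ≤ m} (1 + x²)⁻ⁿ |f⁽ⁱ⁾(x)|` of `𝒪_n^m(ℝ)`. -/
def stepNorm (m n : ℕ) (f : OStep m n) : ℝ := ⨆ p, weighted m n f.1 p

theorem weighted_le_stepNorm {m n : ℕ} (f : OStep m n) (p : Fin (m + 1) × ℝ) :
    weighted m n f.1 p ≤ stepNorm m n f :=
  le_ciSup f.2.2 p

theorem stepNorm_smul {m n : ℕ} (c : ℝ) (f : OStep m n) :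
    stepNorm m n (c • f) = |c| * stepNorm m n f := by
  unfold stepNorm
  rw [Real.mul_iSup_of_nonneg (abs_nonneg c)]
  exact iSup_congr fun p => weighted_smul m n c f.1 p

instance (m n : ℕ) : NormedAddCommGroup (OStep m n) :=
  AddGroupNorm.toNormedAddCommGroup
    { toFun := stepNorm m n
      map_zero' := by simpa using stepNorm_smul (m := m) (n := n) 0 0
      add_le' := fun f g => ciSup_le fun p => (weighted_add_le n f.2.1 g.2.1 p).trans
        (add_le_add (weighted_le_stepNorm f p) (weighted_le_stepNorm g p))
      neg' := fun f => by simpa using stepNorm_smul (-1) f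
      eq_zero_of_map_eq_zero' := fun f hf => by
        apply Subtype.ext
        funext x
        have h := weighted_le_stepNorm f (0, x)
        have h0 : 0 < ((1 + x ^ 2) ^ n)⁻¹ := by positivity
        simp only [hf, weighted, Fin.val_zero, iteratedDeriv_zero] at h
        have h1 : |f.1 x| ≤ 0 := nonpos_of_mul_nonpos_right h h0
        exact abs_nonpos_iff.mp h1 }

theorem norm_def {m n : ℕ} (f : OStep m n) : ‖f‖ = ⨆ p, weighted m n f.1 p := rfl

instance (m n : ℕ) : NormedSpace ℝ (OStep m n) where
  norm_smul_le c f := (stepNorm_smul c f).le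

/-- The vector space `𝒪^m(ℝ) = ⋃_{n ≥ 1} 𝒪_n^m(ℝ)`. -/
def levelSubmodule (m : ℕ) : Submodule ℝ (ℝ → ℝ) where
  carrier := ⋃ n : ℕ+, stepSubmodule m n
  zero_mem' := Set.mem_iUnion.2 ⟨1, Submodule.zero_mem _⟩
  add_mem' := by
    intro f g hf hg
    obtain ⟨n, hn⟩ := Set.mem_iUnion.1 hf
    obtain ⟨k, hk⟩ := Set.mem_iUnion.1 hg
    exact Set.mem_iUnion.2 ⟨max n k, Submodule.add_mem _
      (stepSubmodule_mono m (PNat.coe_le_coe _ _ |>.2 (le_max_left n k)) hn)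
      (stepSubmodule_mono m (PNat.coe_le_coe _ _ |>.2 (le_max_right n k)) hk)⟩
  smul_mem' := by
    intro c f hf
    obtain ⟨n, hn⟩ := Set.mem_iUnion.1 hf
    exact Set.mem_iUnion.2 ⟨n, Submodule.smul_mem _ c hn⟩

/-- The space `𝒪^m(ℝ)`, as a type of its own. -/
def OLevel (m : ℕ) : Type := levelSubmodule m

instance (m : ℕ) : AddCommGroup (OLevel m) := inferInstanceAs (AddCommGroup (levelSubmodule m))

instance (m : ℕ) : Module ℝ (OLevel m) := inferInstanceAs (Module ℝ (levelSubmodule m))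

/-- The inclusion `𝒪_n^m(ℝ) → 𝒪^m(ℝ)`. -/
def stepIncl (m : ℕ) (n : ℕ+) : OStep m n →ₗ[ℝ] OLevel m where
  toFun f := ⟨f.1, Set.mem_iUnion.2 ⟨n, f.2⟩⟩
  map_add' _ _ := rfl
  map_smul' _ _ := rfl

/-- The topology of `𝒪^m(ℝ) = ind_n 𝒪_n^m(ℝ)`, the locally convex inductive limit: the finest
locally convex vector space topology that makes all inclusions `𝒪_n^m(ℝ) → 𝒪^m(ℝ)` continuous. -/
instance levelTopology (m : ℕ) : TopologicalSpace (OLevel m) :=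
  sInf {t : TopologicalSpace (OLevel m) |
    (∀ n : ℕ+, @Continuous (OStep m n) (OLevel m) _ t (stepIncl m n)) ∧
    @IsTopologicalAddGroup (OLevel m) t _ ∧
    @ContinuousSMul ℝ (OLevel m) _ _ t ∧
    @LocallyConvexSpace ℝ (OLevel m) _ _ _ _ t}

instance (m : ℕ) : IsTopologicalAddGroup (OLevel m) :=
  topologicalAddGroup_sInf fun _ ⟨_, ht, _, _⟩ => ht

instance (m : ℕ) : ContinuousSMul ℝ (OLevel m) :=
  continuousSMul_sInf fun _ ⟨_, _, ht, _⟩ => ht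

instance (m : ℕ) : LocallyConvexSpace ℝ (OLevel m) :=
  LocallyConvexSpace.sInf fun _ ⟨_, _, _, ht⟩ => ht

theorem continuous_stepIncl (m : ℕ) (n : ℕ+) : Continuous (stepIncl m n) :=
  continuous_sInf_rng.2 fun _ ht => ht.1 n

theorem continuous_level_of_forall {m : ℕ} {V : Type*} [AddCommGroup V] [Module ℝ V]
    [t : TopologicalSpace V] [IsTopologicalAddGroup V] [ContinuousSMul ℝ V]
    [LocallyConvexSpace ℝ V] (T : OLevel m →ₗ[ℝ] V)
    (h : ∀ n : ℕ+, Continuous (fun f : OStep m n => T (stepIncl m n f))) : Continuous T := by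
  rw [continuous_iff_le_induced]
  exact sInf_le ⟨fun n => continuous_induced_rng.2 (h n), topologicalAddGroup_induced _,
    continuousSMul_induced _, .induced _⟩

/-- The vector space `𝒪_M(ℝ) = ⋂_{m ≥ 1} 𝒪^m(ℝ) = ⋂_{m ≥ 1} ⋃_{n ≥ 1} 𝒪_n^m(ℝ)` of slowly
increasing functions. -/
def slowSubmodule : Submodule ℝ (ℝ → ℝ) := ⨅ m : ℕ+, levelSubmodule m

/-- The space `𝒪_M(ℝ)`, as a type of its own. -/
def OM : Type := slowSubmodule

instance : AddCommGroup OM := inferInstanceAs (AddCommGroup slowSubmodule)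

instance : Module ℝ OM := inferInstanceAs (Module ℝ slowSubmodule)

instance : CoeFun OM (fun _ => ℝ → ℝ) := ⟨fun f => f.1⟩

theorem OM.mem_level (f : OM) (m : ℕ+) : f.1 ∈ levelSubmodule m :=
  (Submodule.mem_iInf _).1 f.2 m

/-- The inclusion `𝒪_M(ℝ) → 𝒪^m(ℝ)`. -/
def levelIncl (m : ℕ+) : OM →ₗ[ℝ] OLevel m where
  toFun f := ⟨f.1, f.mem_level m⟩
  map_add' _ _ := rfl
  map_smul' _ _ := rfl

/-- The topology of `𝒪_M(ℝ) = proj_m 𝒪^m(ℝ)`, the projective limit: the coarsest topology that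
makes all inclusions `𝒪_M(ℝ) → 𝒪^m(ℝ)` continuous. -/
instance : TopologicalSpace OM :=
  ⨅ m : ℕ+, TopologicalSpace.induced (levelIncl m) (levelTopology m)

theorem continuous_levelIncl (m : ℕ+) : Continuous (levelIncl m) :=
  continuous_iInf_dom (i := m) continuous_induced_dom

instance : IsTopologicalAddGroup OM :=
  topologicalAddGroup_iInf fun _ => topologicalAddGroup_induced _

instance : ContinuousSMul ℝ OM :=
  continuousSMul_iInf fun _ => continuousSMul_induced _

instance : LocallyConvexSpace ℝ OM :=
  LocallyConvexSpace.iInf fun _ => .induced _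

/-- The canonical uniform structure of the topological vector space `𝒪_M(ℝ)`. -/
instance : UniformSpace OM := IsTopologicalAddGroup.rightUniformSpace OM

instance : IsUniformAddGroup OM := isUniformAddGroup_of_addCommGroup

/-- Composition with `φ ∈ 𝒪^m(ℝ)` maps each `𝒪_n^m(ℝ)` boundedly into some `𝒪_k^m(ℝ)`. -/
theorem exists_weighted_comp_le {m : ℕ} {φ : ℝ → ℝ} (hφ : φ ∈ levelSubmodule m) (n : ℕ) :
    ∃ (k : ℕ+) (C : ℝ), 0 ≤ C ∧ ∀ (f : OStep m n) (p : Fin (m + 1) × ℝ),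
      weighted m k (f.1 ∘ φ) p ≤ C * ‖f‖ := by
  obtain ⟨q, hφ1, A, hA⟩ := Set.mem_iUnion.1 hφ
  set D : ℝ := max A 1
  have hD1 : 1 ≤ D := le_max_right _ _
  have hD : ∀ (i : ℕ) (_ : i ≤ m) (x : ℝ), |iteratedDeriv i φ x| ≤ D * (1 + x ^ 2) ^ (q : ℕ) := by
    intro i hi x
    have h := (hA ⟨(⟨i, Nat.lt_succ_iff.2 hi⟩, x), rfl⟩).trans (le_max_left A 1)
    have h0 : (0 : ℝ) < (1 + x ^ 2) ^ (q : ℕ) := by positivity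
    simp only [weighted] at h
    rwa [inv_mul_le_iff₀ h0, mul_comm] at h
  let k : ℕ := 2 * q * n + q * m
  refine ⟨⟨k + 1, k.succ_pos⟩, (m.factorial : ℝ) * (2 * D ^ 2) ^ n * D ^ m, by positivity, ?_⟩
  rintro f ⟨i, x⟩
  have hi : (i : ℕ) ≤ m := Nat.lt_succ_iff.1 i.2
  have hi' : ((i : ℕ) : WithTop ℕ∞) ≤ m := by exact_mod_cast hi
  set w : ℝ := 1 + x ^ 2
  have hw : 1 ≤ w := by simp only [w]; nlinarith [sq_nonneg x]
  set B : ℝ := D * w ^ (q : ℕ)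
  have hB : 1 ≤ B := one_le_mul_of_one_le_of_one_le hD1 (one_le_pow₀ hw)
  have hfB : ∀ j, j ≤ (i : ℕ) → ‖iteratedFDeriv ℝ j f.1 (φ x)‖ ≤ (2 * B ^ 2) ^ n * ‖f‖ := by
    intro j hj
    rw [norm_iteratedFDeriv_eq_norm_iteratedDeriv, Real.norm_eq_abs]
    have h := weighted_le_stepNorm f (⟨j, Nat.lt_succ_iff.2 (hj.trans hi)⟩, φ x)
    have h0 : (0 : ℝ) < (1 + φ x ^ 2) ^ n := by positivity
    simp only [weighted] at h
    rw [inv_mul_le_iff₀ h0] at h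
    refine h.trans (mul_le_mul_of_nonneg_right ?_ (norm_nonneg f))
    have h1 : |φ x| ≤ B := by simpa using hD 0 (Nat.zero_le m) x
    have h2 : φ x ^ 2 ≤ B ^ 2 := sq_le_sq' (abs_le.1 h1).1 (abs_le.1 h1).2
    gcongr
    nlinarith
  have hφB : ∀ j, 1 ≤ j → j ≤ (i : ℕ) → ‖iteratedFDeriv ℝ j φ x‖ ≤ B ^ j := by
    intro j hj hji
    rw [norm_iteratedFDeriv_eq_norm_iteratedDeriv, Real.norm_eq_abs]
    exact (hD j (hji.trans hi) x).trans (le_self_pow₀ hB (by omega))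
  have key := norm_iteratedFDeriv_comp_le f.2.1 hφ1 hi' x hfB hφB
  rw [norm_iteratedFDeriv_eq_norm_iteratedDeriv, Real.norm_eq_abs] at key
  have h0 : (0 : ℝ) < w ^ (k + 1) := by positivity
  have hf0 : 0 ≤ ‖f‖ := norm_nonneg f
  change (w ^ (k + 1))⁻¹ * |iteratedDeriv i (f.1 ∘ φ) x| ≤ _
  rw [inv_mul_le_iff₀ h0]
  calc |iteratedDeriv i (f.1 ∘ φ) x|
      ≤ (i : ℕ).factorial * ((2 * B ^ 2) ^ n * ‖f‖) * B ^ (i : ℕ) := key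
    _ ≤ m.factorial * ((2 * B ^ 2) ^ n * ‖f‖) * B ^ m := by gcongr
    _ = w ^ k * ((m.factorial : ℝ) * (2 * D ^ 2) ^ n * D ^ m * ‖f‖) := by
        simp only [B, k]
        ring
    _ ≤ w ^ (k + 1) * ((m.factorial : ℝ) * (2 * D ^ 2) ^ n * D ^ m * ‖f‖) := by
        exact mul_le_mul_of_nonneg_right (pow_le_pow_right₀ hw k.le_succ) (by positivity)

theorem comp_mem_step {m n : ℕ} {φ : ℝ → ℝ} (hφ : φ ∈ levelSubmodule m) (f : OStep m n) {k : ℕ}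
    {C : ℝ} (h : ∀ p, weighted m k (f.1 ∘ φ) p ≤ C) : f.1 ∘ φ ∈ stepSubmodule m k := by
  obtain ⟨q, hφ1, -⟩ := Set.mem_iUnion.1 hφ
  refine ⟨f.2.1.comp hφ1, C, ?_⟩
  rintro _ ⟨p, rfl⟩
  exact h p

theorem comp_mem_level {m : ℕ} {f φ : ℝ → ℝ} (hf : f ∈ levelSubmodule m)
    (hφ : φ ∈ levelSubmodule m) : f ∘ φ ∈ levelSubmodule m := by
  obtain ⟨n, hn⟩ := Set.mem_iUnion.1 hf
  obtain ⟨k, C, -, h⟩ := exists_weighted_comp_le hφ n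
  exact Set.mem_iUnion.2 ⟨k, comp_mem_step hφ (⟨f, hn⟩ : OStep m n) (h ⟨f, hn⟩)⟩

/-- The composition operator `f ↦ f ∘ φ` on `𝒪^m(ℝ)`, as a linear map. -/
def levelComp {m : ℕ} (φ : OLevel m) : OLevel m →ₗ[ℝ] OLevel m where
  toFun f := ⟨f.1 ∘ φ.1, comp_mem_level f.2 φ.2⟩
  map_add' _ _ := rfl
  map_smul' _ _ := rfl

theorem continuous_levelComp {m : ℕ} (φ : OLevel m) : Continuous (levelComp φ) := by
  refine continuous_level_of_forall _ fun n => ?_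
  obtain ⟨k, C, hC, h⟩ := exists_weighted_comp_le φ.2 n
  let T : OStep m n →ₗ[ℝ] OStep m k :=
    { toFun := fun f => ⟨f.1 ∘ φ.1, comp_mem_step φ.2 f (h f)⟩
      map_add' := fun _ _ => rfl
      map_smul' := fun _ _ => rfl }
  have hT : Continuous T :=
    AddMonoidHomClass.continuous_of_bound T C fun f => ciSup_le fun p => h f p
  exact (continuous_stepIncl m k).comp hT

/-- The composition `f ∘ φ` of two elements of `𝒪_M(ℝ)`. -/
def OM.comp (f φ : OM) : OM :=
  ⟨f.1 ∘ φ.1, (Submodule.mem_iInf _).2 fun m => comp_mem_level (f.mem_level m) (φ.mem_level m)⟩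

/-- The composition operator `C_φ : 𝒪_M(ℝ) → 𝒪_M(ℝ)`, `f ↦ f ∘ φ`, for `φ ∈ 𝒪_M(ℝ)`. -/
def compOp (φ : OM) : OM →L[ℝ] OM where
  toFun f := f.comp φ
  map_add' _ _ := rfl
  map_smul' _ _ := rfl
  cont := continuous_iInf_rng.2 fun m => continuous_induced_rng.2 <|
    (continuous_levelComp (levelIncl m φ)).comp (continuous_levelIncl m)

theorem iterate_mem (φ : OM) (n : ℕ+) : φ.1^[(n : ℕ)] ∈ slowSubmodule := by
  induction n using PNat.recOn with
  | one => exact φ.2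
  | succ n ih => exact (OM.comp ⟨_, ih⟩ φ).2

/-- The iterate `φ_n = φ ∘ ⋯ ∘ φ` (`n` times, `n ≥ 1`) of `φ ∈ 𝒪_M(ℝ)`. -/
def OM.iter (φ : OM) (n : ℕ+) : OM := ⟨φ.1^[(n : ℕ)], iterate_mem φ n⟩

/-- A continuous linear operator `T` on a topological vector space is power bounded if its powers
`Tⁿ`, `n ≥ 1`, form an equicontinuous family. -/
def PowerBounded {X : Type*} [AddCommGroup X] [Module ℝ X] [UniformSpace X] (T : X →L[ℝ] X) :
    Prop :=
  Equicontinuous fun (n : ℕ+) (x : X) => (T ^ (n : ℕ)) x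

/-- A sequence of continuous linear operators on `X` converges in `ℒ_s(X)`, the space of continuous
linear operators on `X` with the strong operator topology. -/
def ConvergesStrongly {X : Type*} [AddCommGroup X] [Module ℝ X] [TopologicalSpace X]
    [IsTopologicalAddGroup X] [ContinuousSMul ℝ X] (T : ℕ+ → X →L[ℝ] X) : Prop :=
  ∃ S : X →Lₚₜ[ℝ] X,
    Tendsto (fun n => ContinuousLinearMap.toPointwiseConvergenceCLM ℝ (RingHom.id ℝ) X X (T n))
      atTop (𝓝 S)

end SlowGrowth

end

namespace SlowGrowth

/-! Boundedness of the iterates is the hub. Since `C_ψ id = ψ`, the iterates are the orbit of `id`,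
which is bounded if the operators converge strongly or are equicontinuous. Conversely, a bounded set
of `𝒪_M` lies, for each `m`, in one step `𝒪_n^m` with a common bound (`exists_weighted_le`).
Composition with its members then obeys step-to-step estimates with common constants, which gives
equicontinuity (`compOp_equicontinuous`). Monotonicity of `φ` matters only for strong convergence:
each orbit `φ_n(x)` is monotone in `n` and bounded, so it converges. A bounded sequence of `𝒪_M`
that converges pointwise converges in `𝒪_M` (`exists_tendsto_of_pointwise`); this applies to `φ_n`
and then to every `f ∘ φ_n`. -/

/-! ### From pointwise convergence to locally uniform convergence of all derivatives -/

theorem tendstoLocallyUniformly_of_deriv_le {ι : Type*} {l : Filter ι} {F F' : ι → ℝ → ℝ}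
    {G : ℝ → ℝ} (hF : ∀ i x, HasDerivAt (F i) (F' i x) x)
    (hb : ∀ R, ∃ K, ∀ i x, |x| ≤ R → |F' i x| ≤ K)
    (hG : ∀ x, Tendsto (fun i => F i x) l (𝓝 (G x))) : TendstoLocallyUniformly F G l := by
  have heq : Equicontinuous F := by
    intro x₀
    obtain ⟨K, hK⟩ := hb (|x₀| + 1)
    refine Metric.equicontinuousAt_of_continuity_modulus (fun x => K * |x₀ - x|) ?_ F ?_
    · have : Continuous fun x : ℝ => K * |x₀ - x| := by fun_prop
      simpa using this.tendsto x₀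
    · filter_upwards [Metric.closedBall_mem_nhds x₀ one_pos] with x hx i
      rw [dist_comm, Real.dist_eq, abs_sub_comm x₀ x]
      refine (convex_closedBall x₀ 1).norm_image_sub_le_of_norm_hasDerivWithin_le
        (fun y _ => (hF i y).hasDerivWithinAt) (fun y hy => hK i y ?_)
        (Metric.mem_closedBall_self zero_le_one) hx
      rw [Metric.mem_closedBall, Real.dist_eq] at hy
      have := abs_sub_abs_le_abs_sub y x₀
      linarith
  rw [tendstoLocallyUniformly_iff_forall_isCompact]
  have := (EquicontinuousOn.tendsto_uniformOnFun_iff_pi (𝔖 := {K : Set ℝ | IsCompact K})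
    (fun K hK => hK) (Set.sUnion_eq_univ_iff.2 fun x => ⟨{x}, isCompact_singleton, rfl⟩)
    (fun K _ => heq.equicontinuousOn K) l G).2 (tendsto_pi_nhds.2 hG)
  exact UniformOnFun.tendsto_iff_tendstoUniformlyOn.1 this

/-- By the mean value theorem, the difference quotient with step `t` is within `K * t` of the
derivative, uniformly in the index. For fixed `t` the quotients converge, so the derivatives are
Cauchy. -/
theorem exists_tendsto_deriv {ι : Type*} [Nonempty ι] [SemilatticeSup ι]
    {F F' F'' : ι → ℝ → ℝ} (hF : ∀ i x, HasDerivAt (F i) (F' i x) x)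
    (hF' : ∀ i x, HasDerivAt (F' i) (F'' i x) x)
    (hb : ∀ R, ∃ K, ∀ i x, |x| ≤ R → |F'' i x| ≤ K)
    (h : ∀ x, ∃ y, Tendsto (fun i => F i x) atTop (𝓝 y)) (x : ℝ) :
    ∃ y, Tendsto (fun i => F' i x) atTop (𝓝 y) := by
  obtain ⟨K, hK⟩ := hb (|x| + 1)
  have hK0 : 0 ≤ K := (abs_nonneg _).trans (hK (Classical.arbitrary ι) x (by linarith))
  have slope : ∀ t, 0 < t → t ≤ 1 → ∀ i, |(F i (x + t) - F i x) / t - F' i x| ≤ K * t := by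
    intro t ht ht1 i
    obtain ⟨ξ, ⟨hξ, hξ'⟩, he⟩ := exists_hasDerivAt_eq_slope (F i) (F' i) (a := x) (b := x + t)
      (by linarith) (fun y _ => (hF i y).continuousAt.continuousWithinAt) (fun y _ => hF i y)
    rw [add_sub_cancel_left] at he
    rw [← he]
    have := (convex_closedBall x t).norm_image_sub_le_of_norm_hasDerivWithin_le
        (fun y _ => (hF' i y).hasDerivWithinAt) (C := K) (fun y hy => hK i y ?_)
        (Metric.mem_closedBall_self ht.le) (y := ξ)
        (by rw [Metric.mem_closedBall, Real.dist_eq, abs_le]; constructor <;> linarith)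
    · refine this.trans (mul_le_mul_of_nonneg_left ?_ hK0)
      rw [Real.norm_eq_abs, abs_le]
      constructor <;> linarith
    · rw [Metric.mem_closedBall, Real.dist_eq] at hy
      have := abs_sub_abs_le_abs_sub y x
      linarith
  refine cauchySeq_tendsto_of_complete (Metric.cauchySeq_iff.2 fun ε hε => ?_)
  obtain ⟨t, ht, ht1, htε⟩ : ∃ t, 0 < t ∧ t ≤ 1 ∧ K * t < ε / 3 := by
    refine ⟨min 1 (ε / (3 * (K + 1)) / 2), by positivity, min_le_left _ _, ?_⟩
    calc K * min 1 (ε / (3 * (K + 1)) / 2) ≤ K * (ε / (3 * (K + 1)) / 2) := by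
          gcongr; exact min_le_right _ _
      _ < ε / 3 := by
          rw [div_div, mul_div_assoc', div_lt_div_iff₀ (by positivity) (by positivity)]
          nlinarith
  obtain ⟨y₁, hy₁⟩ := h (x + t)
  obtain ⟨y₂, hy₂⟩ := h x
  obtain ⟨N, hN⟩ := Metric.cauchySeq_iff.1 ((hy₁.sub hy₂).div_const t).cauchySeq (ε / 3)
    (by positivity)
  refine ⟨N, fun m hm n hn => ?_⟩
  have h1 := hN m hm n hn
  have h2 := slope t ht ht1 m
  have h3 := slope t ht ht1 n
  rw [Real.dist_eq, abs_lt] at *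
  rw [abs_le] at h2 h3
  constructor <;> linarith

theorem contDiff_and_tendsto_iteratedDeriv {ι : Type*} [Nonempty ι] [SemilatticeSup ι]
    {F : ι → ℝ → ℝ} {G : ℝ → ℝ} (hF : ∀ (j : ℕ) i, ContDiff ℝ j (F i))
    (hb : ∀ (j : ℕ) R, ∃ K, ∀ i x, |x| ≤ R → |iteratedDeriv j (F i) x| ≤ K)
    (hG : ∀ x, Tendsto (fun i => F i x) atTop (𝓝 (G x))) :
    (∀ j : ℕ, ContDiff ℝ j G) ∧ ∀ j : ℕ,
      TendstoLocallyUniformly (fun i => iteratedDeriv j (F i)) (iteratedDeriv j G) atTop := by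
  have hd : ∀ (j : ℕ) i x,
      HasDerivAt (iteratedDeriv j (F i)) (iteratedDeriv (j + 1) (F i) x) x := by
    intro j i x
    rw [iteratedDeriv_succ]
    exact ((hF (j + 1) i).differentiable_iteratedDeriv j
      (by exact_mod_cast Nat.lt_succ_self j) x).hasDerivAt
  have hex : ∀ (j : ℕ) x, ∃ y, Tendsto (fun i => iteratedDeriv j (F i) x) atTop (𝓝 y) := by
    intro j
    induction j with
    | zero => exact fun x => ⟨G x, by simpa using hG x⟩
    | succ j ih => exact exists_tendsto_deriv (hd j) (hd (j + 1)) (hb (j + 2)) ih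
  -- The pointwise limits `H j` are not yet known to be derivatives of `G`; locally uniform
  -- convergence shows that `H (j + 1)` is the derivative of `H j`.
  choose H hH using hex
  have hu : ∀ j, TendstoLocallyUniformly (fun i => iteratedDeriv j (F i)) (H j) atTop := fun j =>
    tendstoLocallyUniformly_of_deriv_le (hd j) (hb (j + 1)) (hH j)
  have hHd : ∀ j x, HasDerivAt (H j) (H (j + 1) x) x := fun j x =>
    hasDerivAt_of_tendstoLocallyUniformlyOn isOpen_univ
      (tendstoLocallyUniformlyOn_univ.2 (hu (j + 1))) (Eventually.of_forall fun i x _ => hd j i x)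
      (fun x _ => hH j x) (Set.mem_univ x)
  have hHG : ∀ j, iteratedDeriv j G = H j := by
    intro j
    induction j with
    | zero =>
      funext x
      exact tendsto_nhds_unique (by simpa using hG x) (hH 0 x)
    | succ j ih => rw [iteratedDeriv_succ, ih]; exact funext fun x => (hHd j x).deriv
  refine ⟨fun j => ?_, fun j => by rw [hHG]; exact hu j⟩
  have := contDiff_of_differentiable_iteratedDeriv (𝕜 := ℝ) (f := G) (n := j) fun k _ => by
    rw [hHG]; exact fun x => (hHd k x).differentiableAt
  exact_mod_cast this

/-! ### Bounded sets of the inductive limits and of `𝒪_M` -/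

theorem contDiff_of_mem_levelSubmodule {m : ℕ} {f : ℝ → ℝ} (hf : f ∈ levelSubmodule m) :
    ContDiff ℝ m f := by
  obtain ⟨n, hn⟩ := Set.mem_iUnion.1 hf
  exact hn.1

theorem exists_stepIncl_eq {m : ℕ} (f : OLevel m) :
    ∃ (n : ℕ+) (g : OStep m n), stepIncl m n g = f := by
  obtain ⟨n, hn⟩ := Set.mem_iUnion.1 f.2
  exact ⟨n, ⟨f.1, hn⟩, rfl⟩

/-- Bounded subsets of `𝒪^m(ℝ)` are contained and bounded in some `𝒪_n^m(ℝ)`. -/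
theorem exists_weighted_le_of_isVonNBounded {m : ℕ} {B : Set (OLevel m)}
    (hB : Bornology.IsVonNBounded ℝ B) :
    ∃ (n : ℕ+) (A : ℝ), ∀ f ∈ B, ∀ p, weighted m n f.1 p ≤ A := by
  by_contra! h
  choose f hf p hp using fun n : ℕ+ => h n n
  -- Point functionals with `|c n (f n)| > n`. Collected into one continuous linear map `T` to
  -- bounded sequences, they make the image of `B` unbounded.
  let c : ℕ+ → (ℝ → ℝ) → ℝ := fun n g =>
    ((1 + (p n).2 ^ 2) ^ (n : ℕ))⁻¹ * iteratedDeriv (p n).1 g (p n).2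
  have hc : ∀ n g, |c n g| = weighted m n g (p n) := fun n g => by
    simp only [c, weighted]
    rw [abs_mul, abs_of_nonneg (by positivity)]
  -- Bounds all `c n` on the `k`-th step: for `n ≥ k` the weight only decreases, so `1` suffices;
  -- the sum covers the finitely many `n ≤ k`.
  let D : ℕ+ → ℝ := fun k => 1 + ∑ n ∈ Finset.Iic k, (1 + (p n).2 ^ 2) ^ (k : ℕ)
  have hD : ∀ (k : ℕ+) (g : OStep m k) n, |c n g.1| ≤ D k * ‖g‖ := by
    intro k g n
    have hg := weighted_le_stepNorm g (p n)
    change _ ≤ ‖g‖ at hg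
    have hw : 1 ≤ 1 + (p n).2 ^ 2 := by nlinarith [sq_nonneg (p n).2]
    have hs : 0 ≤ ∑ n ∈ Finset.Iic k, (1 + (p n).2 ^ 2) ^ (k : ℕ) :=
      Finset.sum_nonneg fun _ _ => by positivity
    rw [hc]
    rcases le_total k n with hkn | hkn
    · calc weighted m n g.1 (p n) ≤ weighted m k g.1 (p n) := by
            unfold weighted
            gcongr
            exact hkn
        _ ≤ 1 * ‖g‖ := by rwa [one_mul]
        _ ≤ D k * ‖g‖ := by gcongr; simp only [D]; linarith
    · have h1 : (1 + (p n).2 ^ 2) ^ (k : ℕ) ≤ D k := by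
        have := Finset.single_le_sum (f := fun n => (1 + (p n).2 ^ 2) ^ (k : ℕ))
          (fun _ _ => by positivity) (Finset.mem_Iic.2 hkn)
        simp only [D]
        linarith
      refine le_trans ?_ (mul_le_mul h1 hg (weighted_nonneg ..) (by simp only [D]; linarith))
      unfold weighted
      rw [mul_inv_cancel_left₀ (by positivity)]
      exact mul_le_of_le_one_left (abs_nonneg _) (inv_le_one_of_one_le₀ (one_le_pow₀ hw))
  have hbdd : ∀ g : OLevel m, ∃ C, ∀ n, ‖c n g.1‖ ≤ C := by
    intro g
    obtain ⟨k, g, rfl⟩ := exists_stepIncl_eq g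
    exact ⟨_, hD k g⟩
  let T : OLevel m →ₗ[ℝ] BoundedContinuousFunction ℕ+ ℝ :=
    { toFun := fun g => BoundedContinuousFunction.ofNormedAddCommGroupDiscrete (fun n => c n g.1)
        (hbdd g).choose (hbdd g).choose_spec
      map_add' := fun g₁ g₂ => by
        ext n
        have hn : (((p n).1 : ℕ) : WithTop ℕ∞) ≤ m := by
          exact_mod_cast Nat.lt_succ_iff.mp (p n).1.2
        change c n (g₁.1 + g₂.1) = c n g₁.1 + c n g₂.1
        simp only [c]
        rw [iteratedDeriv_add ((contDiff_of_mem_levelSubmodule g₁.2).of_le hn).contDiffAt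
          ((contDiff_of_mem_levelSubmodule g₂.2).of_le hn).contDiffAt, mul_add]
      map_smul' := fun a g => by
        ext n
        change c n (a • g.1) = a * c n g.1
        simp only [c]
        rw [iteratedDeriv_const_smul_field, smul_eq_mul]
        ring }
  have hT : Continuous T := by
    refine continuous_level_of_forall T fun k => ?_
    refine AddMonoidHomClass.continuous_of_bound (T.comp (stepIncl m k)) (D k) fun g => ?_
    refine (BoundedContinuousFunction.norm_le ?_).2 fun n => hD k g n
    exact (abs_nonneg _).trans (hD k g 1)
  have hTB := hB.image (⟨T, hT⟩ : OLevel m →L[ℝ] _)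
  rw [NormedSpace.isVonNBounded_iff'] at hTB
  obtain ⟨M, hM⟩ := hTB
  obtain ⟨n, hn⟩ := exists_nat_gt (max M 0)
  have hn0 : 0 < n := by
    have := (le_max_right M 0).trans_lt hn
    exact_mod_cast this
  have h1 := (BoundedContinuousFunction.norm_coe_le_norm (T (f ⟨n, hn0⟩)) ⟨n, hn0⟩).trans
    (hM _ ⟨_, hf _, rfl⟩)
  have h2 := hp ⟨n, hn0⟩
  replace h2 := h2.trans_eq (hc _ _).symm
  change |c _ _| ≤ M at h1
  have h3 := h2.trans_le h1
  simp only [PNat.mk_coe] at h3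
  exact absurd (le_max_left M 0) (not_le.2 (hn.trans h3))

theorem exists_weighted_le {B : Set OM} (hB : Bornology.IsVonNBounded ℝ B) (m : ℕ+) :
    ∃ (n : ℕ+) (A : ℝ), ∀ f ∈ B, ∀ p, weighted m n f.1 p ≤ A := by
  obtain ⟨n, A, h⟩ := exists_weighted_le_of_isVonNBounded
    (hB.image (⟨levelIncl m, continuous_levelIncl m⟩ : OM →L[ℝ] OLevel m))
  exact ⟨n, A, fun f hf => h _ ⟨f, hf, rfl⟩⟩

/-! ### Equicontinuity of composition with a bounded family -/

theorem abs_iteratedDeriv_le_of_weighted_le {m n : ℕ} {f : ℝ → ℝ} {A : ℝ}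
    (h : ∀ p, weighted m n f p ≤ A) {j : ℕ} (hj : j ≤ m) (x : ℝ) :
    |iteratedDeriv j f x| ≤ A * (1 + x ^ 2) ^ n := by
  have := h (⟨j, Nat.lt_succ_iff.2 hj⟩, x)
  simp only [weighted] at this
  rwa [inv_mul_le_iff₀ (by positivity), mul_comm] at this

/-- Composition with the members of a bounded family maps `𝒪_n^m(ℝ)` into some `𝒪_k^m(ℝ)`, with a
common norm bound. -/
theorem exists_uniform_weighted_comp_le {ι : Type*} {m : ℕ} {φ : ι → ℝ → ℝ}
    (hφ1 : ∀ a, ContDiff ℝ m (φ a)) {q : ℕ} {A : ℝ} (hA : ∀ a p, weighted m q (φ a) p ≤ A)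
    (n : ℕ) :
    ∃ (k : ℕ+) (C : ℝ), 0 ≤ C ∧ ∀ (a : ι) (f : OStep m n) (p : Fin (m + 1) × ℝ),
      weighted m k (f.1 ∘ φ a) p ≤ C * ‖f‖ := by
  set D : ℝ := max A 1
  have hD1 : 1 ≤ D := le_max_right _ _
  -- With `B = D * w ^ q` bounding the derivatives of `φ a`, the growth of `f` costs `(2 * B ^ 2) ^
  -- n` and the chain rule `B ^ m`. The exponent `k + 1` is used only to stay in `ℕ+`.
  let k : ℕ := 2 * q * n + q * m
  refine ⟨⟨k + 1, k.succ_pos⟩, (m.factorial : ℝ) * (2 * D ^ 2) ^ n * D ^ m, by positivity, ?_⟩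
  rintro a f ⟨i, x⟩
  have hD : ∀ (i : ℕ) (_ : i ≤ m), |iteratedDeriv i (φ a) x| ≤ D * (1 + x ^ 2) ^ q := fun i hi =>
    abs_iteratedDeriv_le_of_weighted_le (fun p => (hA a p).trans (le_max_left A 1)) hi x
  have hi : (i : ℕ) ≤ m := Nat.lt_succ_iff.1 i.2
  have hi' : ((i : ℕ) : WithTop ℕ∞) ≤ m := by exact_mod_cast hi
  set w : ℝ := 1 + x ^ 2
  have hw : 1 ≤ w := by simp only [w]; nlinarith [sq_nonneg x]
  set B : ℝ := D * w ^ q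
  have hB : 1 ≤ B := one_le_mul_of_one_le_of_one_le hD1 (one_le_pow₀ hw)
  have hfB : ∀ j, j ≤ (i : ℕ) →
      ‖iteratedFDeriv ℝ j f.1 (φ a x)‖ ≤ (2 * B ^ 2) ^ n * ‖f‖ := by
    intro j hj
    rw [norm_iteratedFDeriv_eq_norm_iteratedDeriv, Real.norm_eq_abs]
    refine (abs_iteratedDeriv_le_of_weighted_le (weighted_le_stepNorm f) (hj.trans hi) _).trans ?_
    rw [mul_comm]
    refine mul_le_mul_of_nonneg_right ?_ (norm_nonneg f)
    have h1 : |φ a x| ≤ B := by simpa using hD 0 (Nat.zero_le m)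
    have h2 : φ a x ^ 2 ≤ B ^ 2 := sq_le_sq' (abs_le.1 h1).1 (abs_le.1 h1).2
    gcongr
    nlinarith
  have hφB : ∀ j, 1 ≤ j → j ≤ (i : ℕ) → ‖iteratedFDeriv ℝ j (φ a) x‖ ≤ B ^ j := by
    intro j hj hji
    rw [norm_iteratedFDeriv_eq_norm_iteratedDeriv, Real.norm_eq_abs]
    exact (hD j (hji.trans hi)).trans (le_self_pow₀ hB (by omega))
  have key := norm_iteratedFDeriv_comp_le f.2.1 (hφ1 a) hi' x hfB hφB
  rw [norm_iteratedFDeriv_eq_norm_iteratedDeriv, Real.norm_eq_abs] at key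
  have h0 : (0 : ℝ) < w ^ (k + 1) := by positivity
  have hf0 : 0 ≤ ‖f‖ := norm_nonneg f
  change (w ^ (k + 1))⁻¹ * |iteratedDeriv i (f.1 ∘ φ a) x| ≤ _
  rw [inv_mul_le_iff₀ h0]
  calc |iteratedDeriv i (f.1 ∘ φ a) x|
      ≤ (i : ℕ).factorial * ((2 * B ^ 2) ^ n * ‖f‖) * B ^ (i : ℕ) := key
    _ ≤ m.factorial * ((2 * B ^ 2) ^ n * ‖f‖) * B ^ m := by gcongr
    _ = w ^ k * ((m.factorial : ℝ) * (2 * D ^ 2) ^ n * D ^ m * ‖f‖) := by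
        simp only [B, k]
        ring
    _ ≤ w ^ (k + 1) * ((m.factorial : ℝ) * (2 * D ^ 2) ^ n * D ^ m * ‖f‖) :=
        mul_le_mul_of_nonneg_right (pow_le_pow_right₀ hw k.le_succ) (by positivity)

/-- Supplies a competitor in the infimum that defines the topology of `𝒪^m(ℝ)`. The abstract `E`
carries no topology that could interfere. -/
theorem exists_topology_of_seminorm {E : Type*} [AddCommGroup E] [Module ℝ E] (p : Seminorm ℝ E) :
    ∃ _ : TopologicalSpace E, IsTopologicalAddGroup E ∧ ContinuousSMul ℝ E ∧
      LocallyConvexSpace ℝ E ∧ Continuous p ∧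
      ∀ {F : Type} [AddCommGroup F] [Module ℝ F] [TopologicalSpace F] [IsTopologicalAddGroup F]
        (T : F →ₗ[ℝ] E), Continuous (p.comp T) → Continuous T := by
  let q : SeminormFamily ℝ E Unit := fun _ => p
  let _ := q.moduleFilterBasis.topology
  have hq : WithSeminorms q := ⟨rfl⟩
  exact ⟨inferInstance, hq.topologicalAddGroup, hq.continuousSMul, hq.toLocallyConvexSpace,
    hq.continuous_seminorm (), fun T h => hq.continuous_of_continuous_comp T fun _ => h⟩

theorem continuous_level_seminorm {m : ℕ} (p : Seminorm ℝ (OLevel m))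
    (h : ∀ n : ℕ+, Continuous (p.comp (stepIncl m n))) : Continuous p := by
  obtain ⟨t, h1, h2, h3, hp, hT⟩ := exists_topology_of_seminorm p
  have hle : levelTopology m ≤ t := sInf_le ⟨fun n => hT _ (h n), h1, h2, h3⟩
  exact continuous_le_dom hle hp

/-- An absolutely convex subset of `𝒪^m(ℝ)` is a neighbourhood of zero as soon as its traces on all
the steps are. -/
theorem mem_nhds_level {m : ℕ} {W : Set (OLevel m)} (hb : Balanced ℝ W) (hc : Convex ℝ W)
    (h : ∀ n : ℕ+, stepIncl m n ⁻¹' W ∈ 𝓝 0) : W ∈ 𝓝 0 := by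
  -- Each element lies in some step, where the trace of `W` is a neighbourhood of zero. Hence the
  -- gauge of `W` is a seminorm.
  have ha : Absorbent ℝ W := by
    refine absorbent_iff_inv_smul.2 fun f => ?_
    obtain ⟨n, g, rfl⟩ := exists_stepIncl_eq f
    filter_upwards [absorbent_iff_inv_smul.1 (absorbent_nhds_zero (𝕜 := ℝ) (h n)) g] with c hc
    simpa using hc
  have hp : Continuous (gaugeSeminorm hb hc ha) := by
    refine continuous_level_seminorm _ fun n => ?_
    refine Seminorm.continuous' (r := 1) (mem_of_superset (h n) fun f hf => ?_)
    rw [Seminorm.mem_closedBall_zero]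
    exact gauge_le_one_of_mem hf
  have : {f | gaugeSeminorm hb hc ha f < 1} ∈ 𝓝 0 :=
    (isOpen_lt hp continuous_const).mem_nhds (by simp)
  exact mem_of_superset this (setOfPred_gauge_lt_one_subset_self hc ha.zero_mem ha)

theorem nhds_OM (f : OM) : 𝓝 f = ⨅ m : ℕ+, comap (levelIncl m) (𝓝 (levelIncl m f)) := by
  rw [nhds_iInf]
  simp only [nhds_induced]

/-- By linearity only zero matters. Equicontinuity there is convergence along `⊤ ×ˢ 𝓝 0`, which the
projective topology tests level by level. -/
theorem equicontinuous_of_level {ι : Type*} {T : ι → OM →L[ℝ] OM}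
    (h : ∀ m : ℕ+, ∀ V ∈ 𝓝 (0 : OLevel m), ∃ W ∈ 𝓝 (0 : OLevel m), ∀ f : OM,
      levelIncl m f ∈ W → ∀ a, levelIncl m (T a f) ∈ V) :
    Equicontinuous fun a f => T a f := by
  refine equicontinuous_of_equicontinuousAt_zero T fun U hU => ?_
  rw [uniformity_eq_comap_nhds_zero] at hU
  obtain ⟨V, hV, hVU⟩ := mem_comap.1 hU
  have key : Tendsto (fun p : ι × OM => T p.1 p.2) (⊤ ×ˢ 𝓝 0) (𝓝 0) := by
    nth_rw 2 [nhds_OM 0]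
    rw [tendsto_iInf]
    refine fun m => tendsto_comap_iff.2 fun V hV => ?_
    rw [map_zero] at hV
    obtain ⟨W, hW, hWV⟩ := h m V hV
    refine mem_map.2 (mem_prod_iff.2 ⟨Set.univ, univ_mem, levelIncl m ⁻¹' W,
      (continuous_levelIncl m).continuousAt.preimage_mem_nhds (by rwa [map_zero]), ?_⟩)
    rintro ⟨a, f⟩ ⟨-, hf⟩
    exact hWV f hf a
  obtain ⟨A, hA, W, hW, hAW⟩ := mem_prod_iff.1 (mem_map.1 (key hV))
  rw [mem_top] at hA
  subst hA
  filter_upwards [hW] with f hf a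
  refine hVU ?_
  have : T a f ∈ V := hAW (Set.mk_mem_prod (Set.mem_univ a) hf)
  simpa using this

/-- One neighbourhood of zero is sent into `V` by every `T a`; it absorbs `x`, so `V` absorbs the
orbit. -/
theorem isVonNBounded_orbit {ι X : Type*} [AddCommGroup X] [Module ℝ X] [UniformSpace X]
    [IsUniformAddGroup X] [ContinuousSMul ℝ X] {T : ι → X →L[ℝ] X}
    (h : Equicontinuous fun a x => T a x) (x : X) :
    Bornology.IsVonNBounded ℝ (Set.range fun a => T a x) := by
  intro V hV
  have h0 : ∀ᶠ y in 𝓝 (0 : X), ∀ a, T a y ∈ V := by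
    have := h 0 {p | p.2 - p.1 ∈ V} (by
      rw [uniformity_eq_comap_nhds_zero]
      exact preimage_mem_comap hV)
    simpa using this
  rw [absorbs_iff_eventually_cobounded_mapsTo]
  filter_upwards [absorbent_iff_inv_smul.1 (absorbent_nhds_zero (𝕜 := ℝ) h0) x] with c hc
  rintro _ ⟨a, rfl⟩
  simpa using hc a

/-- The intersection over `a` of the preimages of an absolutely convex neighbourhood is absolutely
convex. Its trace on each step contains a ball, because the target step and the constant do not
depend on `a`; so `mem_nhds_level` applies. -/
theorem compOp_equicontinuous {ι : Type*} {φ : ι → OM}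
    (h : Bornology.IsVonNBounded ℝ (Set.range φ)) : Equicontinuous fun a f => compOp (φ a) f := by
  refine equicontinuous_of_level fun m V hV => ?_
  obtain ⟨V', ⟨hV', hb, hc⟩, hVV⟩ := (nhds_hasBasis_absConvex ℝ (OLevel m)).mem_iff.1 hV
  obtain ⟨q, A, hA⟩ := exists_weighted_le h m
  refine ⟨⋂ a, levelComp (levelIncl m (φ a)) ⁻¹' V', mem_nhds_level ?_ ?_ fun n => ?_,
    fun f hf a => hVV (Set.mem_iInter.1 hf a)⟩
  · exact balanced_iInter fun a =>
      hb.mulActionHom_preimage (levelComp (levelIncl m (φ a))).toDistribMulActionHom.toMulActionHom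
  · exact convex_iInter fun a => hc.linear_preimage _
  · obtain ⟨k, C, hC, hk⟩ := exists_uniform_weighted_comp_le (φ := fun a => (φ a).1)
      (fun a => contDiff_of_mem_levelSubmodule ((φ a).mem_level m))
      (fun a p => hA _ ⟨a, rfl⟩ p) n
    have hV0 : stepIncl m k ⁻¹' V' ∈ 𝓝 0 :=
      (continuous_stepIncl m k).continuousAt.preimage_mem_nhds (by simpa using hV')
    obtain ⟨ε, hε, hball⟩ := Metric.mem_nhds_iff.1 hV0
    refine Metric.mem_nhds_iff.2 ⟨ε / (C + 1), by positivity, fun f hf => ?_⟩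
    refine Set.mem_iInter.2 fun a => ?_
    let g : OStep m k := ⟨f.1 ∘ (φ a).1, comp_mem_step ((φ a).mem_level m) f (hk a f)⟩
    refine hball (a := g) ?_
    rw [mem_ball_zero_iff] at hf ⊢
    rw [lt_div_iff₀ (by positivity)] at hf
    have : ‖g‖ ≤ C * ‖f‖ := ciSup_le fun p => hk a f p
    nlinarith [norm_nonneg f]

/-! ### Convergence of bounded sequences in `𝒪_M` -/

theorem weighted_le_of_abs_iteratedDeriv_le {m n : ℕ} {f : ℝ → ℝ} {A : ℝ}
    (h : ∀ j ≤ m, ∀ x, |iteratedDeriv j f x| ≤ A * (1 + x ^ 2) ^ n) (p : Fin (m + 1) × ℝ) :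
    weighted m n f p ≤ A := by
  simp only [weighted]
  rw [inv_mul_le_iff₀ (by positivity), mul_comm]
  exact h p.1 (Nat.lt_succ_iff.1 p.1.2) p.2

theorem mem_stepSubmodule {m n : ℕ} {f : ℝ → ℝ} {A : ℝ} (hf : ContDiff ℝ m f)
    (h : ∀ j ≤ m, ∀ x, |iteratedDeriv j f x| ≤ A * (1 + x ^ 2) ^ n) : f ∈ stepSubmodule m n := by
  refine ⟨hf, A, ?_⟩
  rintro _ ⟨p, rfl⟩
  exact weighted_le_of_abs_iteratedDeriv_le h p

theorem id_mem_slowSubmodule : (id : ℝ → ℝ) ∈ slowSubmodule := by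
  refine (Submodule.mem_iInf _).2 fun m => Set.mem_iUnion.2
    ⟨1, mem_stepSubmodule (A := 1) contDiff_id fun j _ x => ?_⟩
  rw [one_mul, PNat.one_coe, pow_one]
  rcases j with _ | j
  · simp only [iteratedDeriv_zero, id_eq, abs_le]
    constructor <;> nlinarith [sq_nonneg (x - 1), sq_nonneg (x + 1)]
  · have : |iteratedDeriv (j + 1) id x| ≤ 1 := by
      rw [iteratedDeriv_succ', deriv_id', iteratedDeriv_const]
      split_ifs <;> simp
    nlinarith [sq_nonneg x]

/-- A bounded sequence in `𝒪_M(ℝ)` that converges pointwise converges in `𝒪_M(ℝ)`. -/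
theorem exists_tendsto_of_pointwise {ι : Type*} [Nonempty ι] [SemilatticeSup ι] {F : ι → OM}
    (hB : Bornology.IsVonNBounded ℝ (Set.range F)) {G : ℝ → ℝ}
    (hG : ∀ x, Tendsto (fun i => F i x) atTop (𝓝 (G x))) :
    ∃ g : OM, g.1 = G ∧ Tendsto F atTop (𝓝 g) := by
  have hcd : ∀ (m : ℕ+) i, ContDiff ℝ m (F i).1 := fun m i =>
    contDiff_of_mem_levelSubmodule ((F i).mem_level m)
  have hbd : ∀ m : ℕ+, ∃ (n : ℕ+) (A : ℝ), 0 ≤ A ∧ ∀ i (j : ℕ), j ≤ m → ∀ x,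
      |iteratedDeriv j (F i).1 x| ≤ A * (1 + x ^ 2) ^ (n : ℕ) := by
    intro m
    obtain ⟨n, A, hA⟩ := exists_weighted_le hB m
    refine ⟨n, A, (weighted_nonneg ..).trans (hA _ ⟨Classical.arbitrary ι, rfl⟩ (0, 0)),
      fun i j hj x => abs_iteratedDeriv_le_of_weighted_le (fun p => hA _ ⟨i, rfl⟩ p) hj x⟩
  obtain ⟨hGs, hGu⟩ := contDiff_and_tendsto_iteratedDeriv (F := fun i => (F i).1) (G := G)
    (fun j i => (hcd j.succPNat i).of_le (by exact_mod_cast Nat.le_succ j))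
    (fun j R => by
      obtain ⟨n, A, hA0, hA⟩ := hbd j.succPNat
      refine ⟨A * (1 + R ^ 2) ^ (n : ℕ), fun i x hx => (hA i j (Nat.le_succ j) x).trans ?_⟩
      have := sq_le_sq' (abs_le.1 hx).1 (abs_le.1 hx).2
      gcongr) hG
  have hGb : ∀ {m : ℕ} {n : ℕ} {A : ℝ}, (∀ i (j : ℕ), j ≤ m → ∀ x,
      |iteratedDeriv j (F i).1 x| ≤ A * (1 + x ^ 2) ^ n) → ∀ j ≤ m, ∀ x,
      |iteratedDeriv j G x| ≤ A * (1 + x ^ 2) ^ n := fun h j hj x =>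
    le_of_tendsto ((tendstoLocallyUniformlyOn_univ.2 (hGu j)).tendsto_at (Set.mem_univ x)).abs
      (Eventually.of_forall fun i => h i j hj x)
  have hGmem : G ∈ slowSubmodule := by
    refine (Submodule.mem_iInf _).2 fun m => ?_
    obtain ⟨n, A, -, hA⟩ := hbd m
    exact Set.mem_iUnion.2 ⟨n, mem_stepSubmodule (hGs m) (hGb hA)⟩
  refine ⟨(⟨G, hGmem⟩ : slowSubmodule), rfl, ?_⟩
  refine (nhds_OM (⟨G, hGmem⟩ : slowSubmodule)).symm ▸ tendsto_iInf.2 fun m =>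
    tendsto_comap_iff.2 ?_
  obtain ⟨n, A, hA0, hA⟩ := hbd m
  -- One extra power of `1 + x ^ 2` makes the tails uniformly small; compact sets are handled by
  -- locally uniform convergence.
  let f : ι → OStep m (n + 1 : ℕ+) := fun i =>
    ⟨(F i).1, stepSubmodule_mono m (Nat.le_succ n) (mem_stepSubmodule (hcd m i) (hA i))⟩
  let g : OStep m (n + 1 : ℕ+) :=
    ⟨G, stepSubmodule_mono m (Nat.le_succ n) (mem_stepSubmodule (hGs m) (hGb hA))⟩
  suffices h : Tendsto f atTop (𝓝 g) from
    ((continuous_stepIncl m (n + 1)).tendsto g).comp h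
  rw [Metric.tendsto_nhds]
  intro ε hε
  -- Outside `[-R, R]` one has `x ^ 2 ≥ R`, so the crude bound `2 * A` is at most `ε / 2 * (1 + x ^
  -- 2)`.
  set R : ℝ := 4 * A / ε + 1
  have hR : 1 ≤ R := le_add_of_nonneg_left (by positivity)
  have hev : ∀ᶠ i in atTop, ∀ j : Fin (m + 1), ∀ x ∈ Set.Icc (-R) R,
      dist (iteratedDeriv j G x) (iteratedDeriv j (F i).1 x) < ε / 2 :=
    eventually_all.2 fun j => Metric.tendstoUniformlyOn_iff.1
      (tendstoLocallyUniformly_iff_forall_isCompact.1 (hGu j) _ isCompact_Icc) _ (half_pos hε)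
  filter_upwards [hev] with i hi
  rw [dist_eq_norm]
  refine lt_of_le_of_lt (ciSup_le fun p => ?_) (half_lt_self hε)
  change weighted m (n + 1 : ℕ) ((F i).1 - G) p ≤ ε / 2
  refine weighted_le_of_abs_iteratedDeriv_le (fun j hj x => ?_) p
  have hj' : (j : WithTop ℕ∞) ≤ (m : ℕ) := by exact_mod_cast hj
  rw [iteratedDeriv_sub ((hcd m i).of_le hj').contDiffAt ((hGs m).of_le hj').contDiffAt]
  have hw : 1 ≤ 1 + x ^ 2 := by nlinarith [sq_nonneg x]
  by_cases hx : x ∈ Set.Icc (-R) R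
  · have h1 := hi ⟨j, Nat.lt_succ_iff.2 hj⟩ x hx
    rw [Real.dist_eq, abs_sub_comm] at h1
    exact h1.le.trans (le_mul_of_one_le_right (by positivity) (one_le_pow₀ hw))
  · have h1 : R ≤ x ^ 2 := by
      rw [Set.mem_Icc, ← abs_le, not_le] at hx
      rw [← sq_abs]
      nlinarith
    have h2 : 4 * A ≤ ε * (1 + x ^ 2) := by
      have : 4 * A / ε ≤ 1 + x ^ 2 := by linarith
      rwa [div_le_iff₀' hε] at this
    calc |iteratedDeriv j (F i).1 x - iteratedDeriv j G x|
        ≤ A * (1 + x ^ 2) ^ (n : ℕ) + A * (1 + x ^ 2) ^ (n : ℕ) :=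
          (abs_sub _ _).trans (add_le_add (hA i j hj x) (hGb hA j hj x))
      _ = 4 * A / 2 * (1 + x ^ 2) ^ (n : ℕ) := by ring
      _ ≤ ε * (1 + x ^ 2) / 2 * (1 + x ^ 2) ^ (n : ℕ) := by gcongr
      _ = ε / 2 * (1 + x ^ 2) ^ ((n : ℕ) + 1) := by ring

end SlowGrowth

/-! ### The equivalences -/

open SlowGrowth in
theorem corollary5p4 (φ : SlowGrowth.OM) (hφ : StrictMono (φ : ℝ → ℝ)) :
    List.TFAE
      [SlowGrowth.ConvergesStrongly (fun n : ℕ+ => SlowGrowth.compOp (φ.iter n)),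
       SlowGrowth.PowerBounded (SlowGrowth.compOp φ),
       Bornology.IsVonNBounded ℝ (Set.range fun n : ℕ+ => φ.iter n)] := by
  have hpow : ∀ n : ℕ+, compOp φ ^ (n : ℕ) = compOp (φ.iter n) := by
    intro n
    have : ∀ (k : ℕ) (f : OM), ((compOp φ ^ k) f).1 = f.1 ∘ φ.1^[k] := by
      intro k
      induction k with
      | zero => exact fun f => rfl
      | succ k ih =>
        intro f
        rw [pow_succ, mul_apply_eq_comp, ih]
        funext x
        simp only [Function.comp_apply, Function.iterate_succ_apply']
        rfl
    ext1 f
    exact Subtype.ext (this n f)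
  let I : OM := ⟨id, id_mem_slowSubmodule⟩
  have hI : ∀ ψ : OM, compOp ψ I = ψ := fun ψ => rfl
  tfae_have 1 → 3 := by
    rintro ⟨S, hS⟩
    rw [PointwiseConvergenceCLM.tendsto_iff_forall_tendsto] at hS
    have h1 : Tendsto (fun n : ℕ+ => φ.iter n) atTop (𝓝 (S I)) := hS I
    -- Reindexing by `ℕ` through a bijection leaves the range unchanged.
    have h2 : Tendsto Nat.succPNat atTop atTop :=
      tendsto_atTop_atTop.2 fun b => ⟨b, fun a ha => ha.trans (Nat.le_succ a)⟩
    have h3 := (h1.comp h2).isVonNBounded_range ℝ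
    have hs : Function.Surjective Nat.succPNat := Equiv.pnatEquivNat.symm.surjective
    rwa [hs.range_comp] at h3
  tfae_have 2 → 3 := fun h => by
    have := isVonNBounded_orbit h I
    simpa only [hpow, hI] using this
  tfae_have 3 → 2 := fun h => by
    have := compOp_equicontinuous h
    simpa only [PowerBounded, hpow] using this
  tfae_have 3 → 1 := by
    intro h
    have hconv : ∀ x, ∃ y, Tendsto (fun n : ℕ+ => φ.iter n x) atTop (𝓝 y) := by
      intro x
      obtain ⟨n, A, hA⟩ := exists_weighted_le h 1
      have hK : ∀ k : ℕ+, |φ.iter k x| ≤ A * (1 + x ^ 2) ^ (n : ℕ) := fun k => by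
        simpa using abs_iteratedDeriv_le_of_weighted_le (hA _ ⟨k, rfl⟩) (Nat.zero_le _) x
      -- As `φ` is increasing, the first step of the orbit decides its direction for good.
      rcases le_total x (φ x) with hx | hx
      · refine ⟨_, tendsto_atTop_ciSup
          (fun k l hkl => hφ.monotone.monotone_iterate_of_le_map hx hkl)
          ⟨A * (1 + x ^ 2) ^ (n : ℕ), ?_⟩⟩
        rintro _ ⟨k, rfl⟩
        exact (abs_le.1 (hK k)).2
      · refine ⟨_, tendsto_atTop_ciInf
          (fun k l hkl => hφ.monotone.antitone_iterate_of_map_le hx hkl)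
          ⟨-(A * (1 + x ^ 2) ^ (n : ℕ)), ?_⟩⟩
        rintro _ ⟨k, rfl⟩
        exact (abs_le.1 (hK k)).1
    choose G hG using hconv
    obtain ⟨ψ, rfl, -⟩ := exists_tendsto_of_pointwise h hG
    refine ⟨ContinuousLinearMap.toPointwiseConvergenceCLM ℝ (RingHom.id ℝ) OM OM (compOp ψ), ?_⟩
    rw [PointwiseConvergenceCLM.tendsto_iff_forall_tendsto]
    intro f
    have hf : Continuous f.1 :=
      (contDiff_of_mem_levelSubmodule (f.mem_level 1)).continuous
    -- The orbit `f ∘ φ_n` is bounded by equicontinuity and converges pointwise to `f ∘ ψ` by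
    -- continuity of `f`.
    obtain ⟨g, hg, hlim⟩ := exists_tendsto_of_pointwise
      (isVonNBounded_orbit (compOp_equicontinuous h) f) (G := f.1 ∘ ψ.1)
      fun x => (hf.tendsto _).comp (hG x)
    obtain rfl : g = compOp ψ f := Subtype.ext hg
    exact hlim
  tfae_finish
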